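/- **Local maximum entropy production (MaxEnt) principle.** Consider a system of conservation laws $$u_t+\sum_{j=1}^d f_j(u)_{x_j}=0,\qquad u(t,\cdot):\mathbb R^d\to\mathbb R^N,\quad t\ge 0,$$ with fluxes $f_j\in C^1(\mathbb R^N;\mathbb R^N)$ and Jacobians $A_j=\partial f_j/\partial u$, and let $\mathcal U$ be a class of states, $\mathcal U\subset BV\cap L^\infty$ (bounded functions $\mathbb R^d\to\mathbb R^N$ of finite total variation on every ball). A *smoothly bounded domain* $\Omega\subset\mathbb R^d$ is a bounded connected open set with smooth boundary; $n$ is its outward unit normal, and boundary values on $\partial\Omega$ are inner traces. For $\zeta:\mathbb R^N\to\mathbb R$ and $Q:\mathbb R^N\to\mathbb R^d$ write $$I_{\zeta,Q}\big(u;\Omega,(t_1,t_2)\big)=\int_\Omega\zeta(u(t,x))\,dx\Big|_{t=t_1}^{t=t_2}+\int_{t_1}^{t_2}\int_{\partial\Omega}Q(u(t,x))\cdot n\,dS\,dt .$$ A *weak solution* is a measurable function $u$, bounded on bounded time intervals, with $u(t,\cdot)\in\mathcal U$ for all $t\ge0$ and $I_{\zeta,Q}(u;\Omega,(t_1,t_2))=0$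 for $\zeta(u)=u^k$, $Q(u)=f^k(u)=(f_1^k(u),\dots,f_d^k(u))$, for all $k=1,\dots,N$, all smoothly bounded domains $\Omega$ and all $0\le t_1<t_2$. Let $\eta\in C^1(\mathbb R^N;\mathbb R)$ be an entropy function with entropy flux $q^\eta=(q_1,\dots,q_d)\in C^1(\mathbb R^N;\mathbb R^d)$, that is, $\nabla\eta(u)^\top A_j(u)=\nabla q_j(u)^\top$ for $j=1,\dots,d$. Then $(\eta,\bar u)$ is a *variational solution* if $\eta$ is strictly convex, $\bar u$ is a weak solution, and for some $\epsilon>0$ $$I_{\eta,q^\eta}\big(\bar u;\Omega,(t_1,t_2)\big)\le I_{\eta,q^\eta}\big(u+\delta u;\Omega,(t_1,t_2)\big)$$ for all smoothly bounded domains $\Omega$, all $0\le t_1<t_2$, all weak solutions $u$ with $u(\tau,\cdot)=\bar u(\tau,\cdot)$ for $0\le\tau\le t_1$, and all $\delta u\in C_0^\infty((t_1,t_2)\times\Omega)$ with $\|\delta u\|_\infty<\epsilon$. **Statement.** Let $(\eta,\bar u)$ be a variational solution, where $\eta$ is an entropy function with flux $q^\eta$. Then $\bar u$ maximizes the local entropy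 production rate: for every smoothly bounded domain $\Omega$, every $t\ge0$ and every weak solution $u$ with $u(\tau,\cdot)=\bar u(\tau,\cdot)$ for $0\le\tau\le t$, 1. $\displaystyle \frac{d_+}{ds}\Big|_{s=t} I_{\eta,q^\eta}\big(\bar u;\Omega,(t,s)\big)\le \frac{d_+}{ds}\Big|_{s=t} I_{\eta,q^\eta}\big(u;\Omega,(t,s)\big)$; 2. if the boundary fluxes $s\mapsto\int_{\partial\Omega}q^\eta(\bar u(s,x))\cdot n\,dS$ and $s\mapsto\int_{\partial\Omega}q^\eta(u(s,x))\cdot n\,dS$ have finite right limits as $s\downarrow t$, then, with the boundary fluxes at time $t$ understood as these right limits (their values at $t$ if they are right-continuous there), $$\frac{d_+}{dt}\int_\Omega\eta(\bar u(t,x))\,dx+\int_{\partial\Omega}q^\eta(\bar u(t,x))\cdot n\,dS\ \le\ \frac{d_+}{dt}\int_\Omega\eta(u(t,x))\,dx+\int_{\partial\Omega}q^\eta(u(t,x))\cdot n\,dS .$$ No existence of forward derivatives is assumed: both (1) and (2) hold, in $[-\infty,\infty]$, with $\frac{d_+}{dt}$ read on both sides as the upper forward derivative $\limsup_{h\downarrow0}\frac{g(t+h)-g(t)}h$,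 and also with $\frac{d_+}{dt}$ read on both sides as the lower forward derivative ($\liminf$). Where the forward derivatives exist, they coincide with both. -/

import Mathlib

open MeasureTheory Filter Topology
open scoped ContDiff

namespace HypCL

/-- `ℝⁿ` with its Euclidean norm. -/
abbrev E (n : ℕ) : Type := EuclideanSpace ℝ (Fin n)

noncomputable section

/-! ### Smoothly bounded domains, unit normal, boundary traces -/

/-- A smoothly bounded domain of `ℝᵈ`: a bounded, connected (non-empty) open set which, near each
of its boundary points, is a sublevel set `{φ < 0}` of a smooth function with non-zero
differential. -/
structure IsSmoothDomain {d : ℕ} (Ω : Set (E d)) : Prop where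
  isOpen : IsOpen Ω
  isConnected : IsConnected Ω
  isBounded : Bornology.IsBounded Ω
  smooth_boundary : ∀ x ∈ frontier Ω, ∃ φ : E d → ℝ, ContDiff ℝ ∞ φ ∧ fderiv ℝ φ x ≠ 0 ∧
    ∀ᶠ y in 𝓝 x, (y ∈ Ω ↔ φ y < 0)

/-- The signed distance to the boundary of `Ω`, negative inside `Ω`. -/
def signedDist {d : ℕ} (Ω : Set (E d)) (x : E d) : ℝ :=
  Metric.infDist x Ω - Metric.infDist x Ωᶜ

/-- The outward unit normal at the points of `∂Ω`: the gradient of the signed distance. -/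
def normal {d : ℕ} (Ω : Set (E d)) (x : E d) : E d := gradient (signedDist Ω) x

/-- The (inner) trace on `∂Ω` of a function `v`, as the limit at a boundary point `x` of the
averages of `v` over `B(x, r) ∩ Ω`, along the radii `r = 1 / (n + 1)`. For a bounded function of
bounded variation this is the usual trace at almost every boundary point. -/
def trace {d N : ℕ} (Ω : Set (E d)) (v : E d → E N) (x : E d) : E N :=
  limUnder atTop (fun n : ℕ => ⨍ y in Metric.ball x (1 / ((n : ℝ) + 1)) ∩ Ω, v y)

/-- `∫_{∂Ω} Q(v) · n dS`, with `dS` the `(d-1)`-dimensional surface measure. -/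
def boundaryFlux {d N : ℕ} (Q : E N → E d) (Ω : Set (E d)) (v : E d → E N) : ℝ :=
  ∫ x in frontier Ω, inner ℝ (Q (trace Ω v x)) (normal Ω x) ∂(μHE[d - 1] : Measure (E d))

/-- `∫_Ω ζ(v) dx`. -/
def content {d N : ℕ} (ζ : E N → ℝ) (Ω : Set (E d)) (v : E d → E N) : ℝ :=
  ∫ x in Ω, ζ (v x)

/-- `∫_Ω ζ(u(t,·)) dx |_{t = t₁}^{t = t₂} + ∫_{t₁}^{t₂} ∫_{∂Ω} Q(u(t,·)) · n dS dt`. -/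
def production {d N : ℕ} (ζ : E N → ℝ) (Q : E N → E d) (Ω : Set (E d)) (u : ℝ → E d → E N)
    (t₁ t₂ : ℝ) : ℝ :=
  content ζ Ω (u t₂) - content ζ Ω (u t₁) + ∫ t in t₁..t₂, boundaryFlux Q Ω (u t)

/-! ### States and weak solutions -/

/-- The divergence of a vector field. -/
def div {d : ℕ} (φ : E d → E d) (x : E d) : ℝ :=
  ∑ j : Fin d, fderiv ℝ φ x (EuclideanSpace.single j 1) j

/-- The class `BV ∩ L^∞`: essentially bounded measurable functions `v : ℝᵈ → ℝᴺ` whose components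
have finite total variation in every ball. -/
def BVLinf (d N : ℕ) : Set (E d → E N) :=
  {v | MemLp v ⊤ (volume : Measure (E d)) ∧
    ∀ (k : Fin N) (R : ℝ), ∃ C : ℝ, ∀ φ : E d → E d, ContDiff ℝ ∞ φ → HasCompactSupport φ →
      tsupport φ ⊆ Metric.ball 0 R → (∀ x, ‖φ x‖ ≤ 1) → ∫ x, v x k * div φ x ≤ C}

/-- The flux vector `f^k = (f_1^k, …, f_d^k)` of the `k`-th conserved quantity. -/
def fluxRow {d N : ℕ} (f : Fin d → E N → E N) (k : Fin N) (w : E N) : E d :=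
  WithLp.toLp 2 (fun j => f j w k)

/-- `u` is a weak solution of `u_t + ∑ⱼ fⱼ(u)_{xⱼ} = 0` with states in `𝒰`: a measurable function
of `(t, x)`, bounded on bounded time intervals, with `u(t,·) ∈ 𝒰` for `t ≥ 0`, which satisfies the
integrated conservation laws over all smoothly bounded domains and all time intervals. -/
structure IsWeakSolution {d N : ℕ} (f : Fin d → E N → E N) (𝒰 : Set (E d → E N))
    (u : ℝ → E d → E N) : Prop where
  measurable : Measurable (Function.uncurry u)
  mem_states : ∀ t, 0 ≤ t → u t ∈ 𝒰
  bounded : ∀ T : ℝ, ∃ M : ℝ, ∀ t ∈ Set.Icc 0 T, ∀ᵐ x, ‖u t x‖ ≤ M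
  conservation : ∀ (k : Fin N) (Ω : Set (E d)), IsSmoothDomain Ω → ∀ t₁ t₂ : ℝ, 0 ≤ t₁ → t₁ < t₂ →
    production (fun w => w k) (fluxRow f k) Ω u t₁ t₂ = 0

/-- `u(τ,·) = ū(τ,·)` for all times `0 ≤ τ ≤ t`. -/
def AgreeUpTo {d N : ℕ} (u ubar : ℝ → E d → E N) (t : ℝ) : Prop :=
  ∀ τ, 0 ≤ τ → τ ≤ t → u τ =ᵐ[volume] ubar τ

/-! ### Entropy pairs and variational solutions -/

/-- `η` is an entropy function of the system with entropy flux `q`: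
`∇η(u)ᵀ Aⱼ(u) = ∇qⱼ(u)ᵀ` with `Aⱼ = ∂fⱼ/∂u`, for all `j`. -/
structure IsEntropyPair {d N : ℕ} (f : Fin d → E N → E N) (η : E N → ℝ) (q : E N → E d) :
    Prop where
  contDiff_entropy : ContDiff ℝ 1 η
  contDiff_flux : ContDiff ℝ 1 q
  compat : ∀ (j : Fin d) (w : E N),
    (fderiv ℝ η w).comp (fderiv ℝ (f j) w) = fderiv ℝ (fun z => q z j) w

/-- The perturbations `δu ∈ C_0^∞((t₁,t₂) × Ω)` with `‖δu‖_∞ < ε`. -/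
structure IsPerturbation {d N : ℕ} (Ω : Set (E d)) (t₁ t₂ ε : ℝ) (δ : ℝ → E d → E N) :
    Prop where
  smooth : ContDiff ℝ ∞ (Function.uncurry δ)
  compact : HasCompactSupport (Function.uncurry δ)
  support : tsupport (Function.uncurry δ) ⊆ Set.Ioo t₁ t₂ ×ˢ Ω
  small : ∀ t x, ‖δ t x‖ < ε

/-- For an entropy pair `(η, q)`, `(η, ū)` is a variational solution: `η` is strictly convex, `ū`
is a weak solution, and on every time interval and every smoothly bounded domain `ū` minimizes the
action among the small perturbations `u + δu` of weak solutions `u` which agree with `ū` up to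
the initial time `t₁`. -/
structure IsVariationalSolution {d N : ℕ} (f : Fin d → E N → E N) (𝒰 : Set (E d → E N))
    (η : E N → ℝ) (q : E N → E d) (ubar : ℝ → E d → E N) : Prop where
  observable : StrictConvexOn ℝ Set.univ η
  weak : IsWeakSolution f 𝒰 ubar
  minimizer : ∃ ε : ℝ, 0 < ε ∧ ∀ (Ω : Set (E d)), IsSmoothDomain Ω →
    ∀ t₁ t₂ : ℝ, 0 ≤ t₁ → t₁ < t₂ →
    ∀ u δ : ℝ → E d → E N, IsWeakSolution f 𝒰 u → AgreeUpTo u ubar t₁ →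
      IsPerturbation Ω t₁ t₂ ε δ →
      production η q Ω ubar t₁ t₂ ≤ production η q Ω (fun t x => u t x + δ t x) t₁ t₂

/-! ### Forward rates -/

/-- The upper forward derivative `limsup_{h ↓ 0} (g(t+h) - g(t)) / h`. -/
def upperForwardDeriv (g : ℝ → ℝ) (t : ℝ) : EReal :=
  limsup (fun h : ℝ => (((g (t + h) - g t) / h : ℝ) : EReal)) (𝓝[>] 0)

/-- The lower forward derivative `liminf_{h ↓ 0} (g(t+h) - g(t)) / h`. The forward derivative
`d₊g/dt` exists iff it is finite and equal to the upper one. -/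
def lowerForwardDeriv (g : ℝ → ℝ) (t : ℝ) : EReal :=
  liminf (fun h : ℝ => (((g (t + h) - g t) / h : ℝ) : EReal)) (𝓝[>] 0)

end

end HypCL

/-! Choosing `δ = 0` in the minimizing property on `(t, s)` gives `production … ubar t s ≤
production … u t s` for every `s > t` (`IsVariationalSolution.production_le`). Both sides vanish at
`s = t`, so their difference quotients are ordered and so are the limsups and liminfs. This is (1).

For (2), the quotient of the production is the quotient of the content plus the average of the
boundary flux over `(t, t + h)`. The average tends to the finite right limit of the flux
(`tendsto_forwardAverage`), and a finite limit can be pulled out of an extended-real limsup or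
liminf.

The averaging step needs the flux to be measurable in time. This follows from joint measurability of
`u` by Fubini, once `∂Ω` has finite surface measure. By compactness that is a local question: near a
regular point, a zero set maps injectively, with Lipschitz inverse, onto a bounded subset of
`ℝ^(d-1)`. -/

namespace HypCL

open scoped NNReal

/-! ### Hypersurfaces have locally finite surface measure -/

/-- The common zeros of a nonzero linear functional and of suitable `n - 1` further coordinates
are trivial. -/
theorem exists_coordinates_ker {V : Type*} [NormedAddCommGroup V] [InnerProductSpace ℝ V]
    [FiniteDimensional ℝ V] {n : ℕ} (hn : Module.finrank ℝ V = n)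
    {L : V →L[ℝ] ℝ} (hL : L ≠ 0) :
    ∃ T : V →L[ℝ] (Fin (n - 1) → ℝ), (L.prod T).ker = ⊥ := by
  have hrange : L.toLinearMap.range = ⊤ := by
    apply LinearMap.range_eq_top.2
    apply LinearMap.surjective
    exact fun h => hL (ContinuousLinearMap.coe_injective h)
  have hdim : Module.finrank ℝ L.toLinearMap.ker = n - 1 := by
    have h := L.toLinearMap.finrank_range_add_finrank_ker
    rw [hrange, finrank_top, Module.finrank_self, hn] at h
    omega
  let e : L.toLinearMap.ker ≃L[ℝ] (Fin (n - 1) → ℝ) :=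
    ContinuousLinearEquiv.ofFinrankEq (by simp [hdim])
  -- Coordinates of the orthogonal projection onto `ker L`: the projection fixes `ker L`, so a
  -- vector killed by both maps is zero.
  refine ⟨e.toContinuousLinearMap.comp L.toLinearMap.ker.orthogonalProjectionOnto, ?_⟩
  rw [Submodule.eq_bot_iff]
  intro w hw
  have hw' : L w = 0 ∧ e (L.toLinearMap.ker.orthogonalProjectionOnto w) = 0 := by
    simpa [Prod.ext_iff] using hw
  have hproj := (map_eq_zero_iff e e.injective).1 hw'.2
  have hmem : w ∈ L.toLinearMap.ker := hw'.1
  have := Submodule.orthogonalProjectionOnto_mem_subspace_eq_self (⟨w, hmem⟩ : L.toLinearMap.ker)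
  have h2 := congrArg Subtype.val (this.symm.trans hproj)
  simpa using h2

/-- Near a regular point the zero set of a strictly differentiable function has finite Hausdorff
measure of codimension one. -/
theorem exists_nhds_hausdorffMeasure_zeroSet_lt_top {d : ℕ} {φ : E d → ℝ} {L : E d →L[ℝ] ℝ}
    {x : E d} (hφ : HasStrictFDerivAt φ L x) (hL : L ≠ 0) :
    ∃ s ∈ 𝓝 x, (μH[(d - 1 : ℕ)] : Measure (E d)) (s ∩ {y | φ y = 0}) < ⊤ := by
  obtain ⟨T, hT⟩ := exists_coordinates_ker (n := d) (by simp) hL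
  obtain ⟨K, hK, hanti⟩ := (L.prod T).toLinearMap.exists_antilipschitzWith hT
  -- With error `(2 * K)⁻¹`, the `L`-part of the antilipschitz bound is at most half the distance
  -- and can be absorbed.
  obtain ⟨s, hs, happrox⟩ := hφ.approximates_deriv_on_nhds (c := (2 * K)⁻¹)
    (Or.inr (by positivity))
  -- The ball makes the image under `T` bounded, hence of finite Lebesgue measure.
  refine ⟨s ∩ Metric.ball x 1, inter_mem hs (Metric.ball_mem_nhds x one_pos), ?_⟩
  set S : Set (E d) := s ∩ Metric.ball x 1 ∩ {y | φ y = 0}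
  have hK' : (0 : ℝ) < K := hK
  -- On the zero set `φ y - φ z = 0`, so `L (y - z)` is pure linearization error. If it dominates
  -- the max norm, then `dist y z ≤ dist y z / 2`, forcing `y = z`.
  have key : ∀ y ∈ S, ∀ z ∈ S, dist y z ≤ K * dist (T y) (T z) := by
    intro y hy z hz
    have h1 := happrox y hy.1.1 z hz.1.1
    rw [show φ y = 0 from hy.2, show φ z = 0 from hz.2, sub_zero, zero_sub, norm_neg] at h1
    have h2 := hanti.le_mul_dist y z
    have h3 : dist ((L.prod T).toLinearMap y) ((L.prod T).toLinearMap z) =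
        max (dist (L y) (L z)) (dist (T y) (T z)) := rfl
    rw [h3] at h2
    have h4 : dist (L y) (L z) ≤ (2 * K)⁻¹ * dist y z := by
      rw [dist_eq_norm, dist_eq_norm, ← map_sub]
      simpa using h1
    rcases le_total (dist (L y) (L z)) (dist (T y) (T z)) with h | h
    · rwa [max_eq_right h] at h2
    · rw [max_eq_left h] at h2
      have h5 : K * dist (L y) (L z) ≤ dist y z / 2 := by
        calc K * dist (L y) (L z) ≤ K * ((2 * K)⁻¹ * dist y z) := by gcongr
          _ = dist y z / 2 := by push_cast; field_simp
      have h6 : dist y z ≤ 0 := by linarith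
      exact h6.trans (by positivity)
  have hantiS : AntilipschitzWith K (fun y : S => T y) :=
    AntilipschitzWith.of_le_mul_dist fun y z => key y y.2 z z.2
  have hvol : (μH[(d - 1 : ℕ)] : Measure (Fin (d - 1) → ℝ)) (T '' S) < ⊤ := by
    have h : (μH[(d - 1 : ℕ)] : Measure (Fin (d - 1) → ℝ)) = volume := by
      simpa using hausdorffMeasure_pi_real (ι := Fin (d - 1))
    rw [h]
    refine (T.lipschitz.isBounded_image ?_).measure_lt_top
    exact Metric.isBounded_ball.subset fun y hy => hy.1.2
  have h := hantiS.le_hausdorffMeasure_image (d := ((d - 1 : ℕ) : ℝ)) (by positivity) Set.univ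
  have himage : (fun y : S => T y) '' Set.univ = T '' S := by
    ext; simp
  rw [himage, ← isometry_subtype_coe.hausdorffMeasure_image (Or.inl (by positivity)),
    Set.image_univ, Subtype.range_coe] at h
  exact h.trans_lt (ENNReal.mul_lt_top (by finiteness) hvol)

/-- The boundary of a smoothly bounded domain has finite surface measure. -/
theorem IsSmoothDomain.surfaceMeasure_frontier_lt_top {d : ℕ} {Ω : Set (E d)}
    (hΩ : IsSmoothDomain Ω) : (μHE[d - 1] : Measure (E d)) (frontier Ω) < ⊤ := by
  have hcompact : IsCompact (frontier Ω) :=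
    Metric.isCompact_of_isClosed_isBounded isClosed_frontier
      (hΩ.isBounded.closure.subset frontier_subset_closure)
  refine hcompact.measure_lt_top_of_nhdsWithin fun x hx => ?_
  obtain ⟨φ, hφ, hL, hloc⟩ := hΩ.smooth_boundary x hx
  obtain ⟨s, hs, hfin⟩ := exists_nhds_hausdorffMeasure_zeroSet_lt_top
    (hφ.contDiffAt.hasStrictFDerivAt (by simp)) hL
  obtain ⟨V, hVsub, hVo, hxV⟩ := eventually_nhds_iff.1 hloc
  refine ⟨(s ∩ V) ∩ frontier Ω, inter_mem (mem_nhdsWithin_of_mem_nhds (inter_mem hs (hVo.mem_nhds hxV)))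
    self_mem_nhdsWithin, ?_⟩
  -- A boundary point with `φ > 0` would have a neighbourhood missing `Ω`; one with `φ < 0` would
  -- lie in the open set `Ω`.
  have hsub : s ∩ V ∩ frontier Ω ⊆ s ∩ {y | φ y = 0} := by
    rintro y ⟨⟨hys, hyV⟩, hy⟩
    refine ⟨hys, le_antisymm ?_ ?_⟩
    · by_contra! hpos
      obtain ⟨z, ⟨hzV, hz⟩, hzΩ⟩ := mem_closure_iff.1 (frontier_subset_closure hy)
        (V ∩ {z | 0 < φ z}) (hVo.inter (isOpen_lt continuous_const hφ.continuous)) ⟨hyV, hpos⟩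
      exact lt_asymm hz ((hVsub z hzV).1 hzΩ)
    · have hyΩ : y ∉ Ω := by
        rw [hΩ.isOpen.frontier_eq] at hy
        exact hy.2
      exact not_lt.1 fun h => hyΩ ((hVsub y hyV).2 h)
  refine (measure_mono hsub).trans_lt ?_
  rw [Measure.euclideanHausdorffMeasure_def, Measure.smul_apply]
  exact ENNReal.mul_lt_top ENNReal.coe_lt_top hfin

/-! ### Measurability in time of the boundary flux -/

/-- The derivative of an arbitrary real function on `E d` is measurable, so no regularity of
`signedDist Ω` is involved. -/
theorem measurable_normal {d : ℕ} (Ω : Set (E d)) : Measurable (normal Ω) :=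
  (InnerProductSpace.toDual ℝ (E d)).symm.continuous.measurable.comp
    (measurable_fderiv ℝ (signedDist Ω))

/-- The trace of a jointly measurable function is jointly measurable. -/
theorem stronglyMeasurable_trace {d N : ℕ} {Ω : Set (E d)} (hΩ : MeasurableSet Ω)
    {u : ℝ → E d → E N} (hu : Measurable (Function.uncurry u)) :
    StronglyMeasurable (fun p : ℝ × E d => trace Ω (u p.1) p.2) := by
  refine StronglyMeasurable.limUnder fun n => ?_
  set r : ℝ := 1 / ((n : ℝ) + 1)
  -- Encoding the moving ball as one measurable set in the product turns the average into a
  -- parameter integral over a fixed space.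
  have hset : MeasurableSet {z : (ℝ × E d) × E d | z.2 ∈ Metric.ball z.1.2 r ∩ Ω} := by
    refine MeasurableSet.inter ?_ (measurable_snd hΩ)
    exact measurableSet_lt (measurable_snd.dist measurable_fst.snd) measurable_const
  have hint : StronglyMeasurable fun p : ℝ × E d => ∫ y in Metric.ball p.2 r ∩ Ω, u p.1 y := by
    have h : StronglyMeasurable fun z : (ℝ × E d) × E d =>
        {z : (ℝ × E d) × E d | z.2 ∈ Metric.ball z.1.2 r ∩ Ω}.indicator
          (fun z => u z.1.1 z.2) z :=
      ((hu.comp (measurable_fst.fst.prodMk measurable_snd)).stronglyMeasurable).indicator hset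
    have heq : (fun p : ℝ × E d => ∫ y in Metric.ball p.2 r ∩ Ω, u p.1 y) = fun p => ∫ y,
        {z : (ℝ × E d) × E d | z.2 ∈ Metric.ball z.1.2 r ∩ Ω}.indicator
          (fun z => u z.1.1 z.2) (p, y) := by
      funext p
      rw [← integral_indicator (Metric.isOpen_ball.measurableSet.inter hΩ)]
      rfl
    rw [heq]
    exact h.integral_prod_right' (ν := volume)
  have hvol : Measurable fun p : ℝ × E d => volume.real (Metric.ball p.2 r ∩ Ω) :=
    (measurable_measure_prodMk_left hset).ennreal_toReal
  simp only [setAverage_eq]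
  exact hvol.inv.stronglyMeasurable.smul hint

/-- Over a domain whose boundary has finite surface measure, the boundary flux of a jointly
measurable function depends measurably on time. -/
theorem stronglyMeasurable_boundaryFlux {d N : ℕ} {Q : E N → E d} (hQ : Continuous Q)
    {Ω : Set (E d)} (hΩ : MeasurableSet Ω)
    (hfin : (μHE[d - 1] : Measure (E d)) (frontier Ω) < ⊤)
    {u : ℝ → E d → E N} (hu : Measurable (Function.uncurry u)) :
    StronglyMeasurable (fun s => boundaryFlux Q Ω (u s)) := by
  -- Makes the restricted surface measure finite, as measurability of the partial integral requires
  -- s-finiteness.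
  have : Fact ((μHE[d - 1] : Measure (E d)) (frontier Ω) < ⊤) := ⟨hfin⟩
  refine StronglyMeasurable.integral_prod_right' (ν := (μHE[d - 1] : Measure (E d)).restrict
    (frontier Ω)) (f := fun p : ℝ × E d => inner ℝ (Q (trace Ω (u p.1) p.2)) (normal Ω p.2)) ?_
  exact (hQ.comp_stronglyMeasurable (stronglyMeasurable_trace hΩ hu)).inner
    ((measurable_normal Ω).comp measurable_snd).stronglyMeasurable

/-! ### Forward rates -/

/-- If `g` has a finite right limit `b` at `t`, its averages over `(t, t + h)` tend to `b`. -/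
theorem tendsto_forwardAverage {g : ℝ → ℝ} (hg : StronglyMeasurable g) {t b : ℝ}
    (hb : Tendsto g (𝓝[>] t) (𝓝 b)) :
    Tendsto (fun h : ℝ => (∫ s in t..(t + h), g s) / h) (𝓝[>] 0) (𝓝 b) := by
  have hshift : Tendsto (fun h : ℝ => t + h) (𝓝[>] 0) (𝓝[≥] t) := by
    refine tendsto_nhdsWithin_iff.2 ⟨?_, ?_⟩
    · have : Tendsto (fun h : ℝ => t + h) (𝓝 0) (𝓝 (t + 0)) :=
        (continuous_const.add continuous_id).tendsto 0
      rw [add_zero] at this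
      exact this.mono_left nhdsWithin_le_nhds
    · filter_upwards [self_mem_nhdsWithin] with h hh
      simpa using (Set.mem_Ioi.1 hh).le
  -- The right-sided filter pair ignores the value `g t`; only the limit along `𝓝[>] t` matters.
  have ho := intervalIntegral.integral_sub_linear_isLittleO_of_tendsto_ae
    (a := t) (l := 𝓝[≥] t) (l' := 𝓝[>] t) (lt := 𝓝[>] (0 : ℝ)) (f := g) (c := b)
    hg.aestronglyMeasurable.stronglyMeasurableAtFilter (hb.mono_left inf_le_left)
    (u := fun _ => t) (v := fun h => t + h)
    (tendsto_const_pure.mono_right (pure_le_nhdsWithin Set.self_mem_Ici)) hshift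
  have hlim := ho.tendsto_div_nhds_zero.add_const b
  rw [zero_add] at hlim
  refine hlim.congr' ?_
  filter_upwards [self_mem_nhdsWithin] with h hh
  have : h ≠ 0 := (Set.mem_Ioi.1 hh).ne'
  simp only [Pi.sub_apply, add_sub_cancel_left, smul_eq_mul]
  field_simp
  ring

theorem production_self {d N : ℕ} (ζ : E N → ℝ) (Q : E N → E d) (Ω : Set (E d))
    (u : ℝ → E d → E N) (t : ℝ) : production ζ Q Ω u t t = 0 := by
  simp [production]

theorem upperForwardDeriv_mono {g₁ g₂ : ℝ → ℝ} {t : ℝ} (h₀ : g₁ t = g₂ t)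
    (h : ∀ s, t < s → g₁ s ≤ g₂ s) : upperForwardDeriv g₁ t ≤ upperForwardDeriv g₂ t := by
  refine limsup_le_limsup ?_
  filter_upwards [self_mem_nhdsWithin] with r hr
  have hr : 0 < r := hr
  have := h (t + r) (by linarith)
  rw [h₀]
  exact_mod_cast (by gcongr)

theorem lowerForwardDeriv_mono {g₁ g₂ : ℝ → ℝ} {t : ℝ} (h₀ : g₁ t = g₂ t)
    (h : ∀ s, t < s → g₁ s ≤ g₂ s) : lowerForwardDeriv g₁ t ≤ lowerForwardDeriv g₂ t := by
  refine liminf_le_liminf ?_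
  filter_upwards [self_mem_nhdsWithin] with r hr
  have hr : 0 < r := hr
  have := h (t + r) (by linarith)
  rw [h₀]
  exact_mod_cast (by gcongr)

/-- Subadditivity of limsup gives `≤`, and `limsup a + liminf c ≤ limsup (a + c)` gives `≥`. Since
`b` is finite, `∞ - ∞` never occurs, even if `limsup a` is infinite. -/
theorem limsup_add_of_tendsto {α : Type*} {l : Filter α} [l.NeBot] {a : α → EReal} {c : α → ℝ}
    {b : ℝ} (hc : Tendsto c l (𝓝 b)) :
    limsup (fun x => a x + (c x : EReal)) l = limsup a l + (b : EReal) := by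
  have hc' : Tendsto (fun x => (c x : EReal)) l (𝓝 (b : EReal)) :=
    (continuous_coe_real_ereal.tendsto b).comp hc
  refine le_antisymm ?_ ?_
  · refine (EReal.limsup_add_le ?_ ?_).trans_eq (by rw [hc'.limsup_eq])
    · simp [hc'.limsup_eq]
    · simp [hc'.limsup_eq]
  · exact (by rw [hc'.liminf_eq] : limsup a l + (b : EReal) = _).trans_le EReal.le_limsup_add

theorem liminf_add_of_tendsto {α : Type*} {l : Filter α} [l.NeBot] {a : α → EReal} {c : α → ℝ}
    {b : ℝ} (hc : Tendsto c l (𝓝 b)) :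
    liminf (fun x => a x + (c x : EReal)) l = liminf a l + (b : EReal) := by
  have hc' : Tendsto (fun x => (c x : EReal)) l (𝓝 (b : EReal)) :=
    (continuous_coe_real_ereal.tendsto b).comp hc
  refine le_antisymm ?_ ?_
  · have h := EReal.liminf_add_le (u := fun x => (c x : EReal)) (v := a) (f := l)
      (by simp [hc'.limsup_eq]) (by simp [hc'.limsup_eq])
    rw [hc'.limsup_eq, add_comm (b : EReal)] at h
    simpa only [Pi.add_def, add_comm] using h
  · exact (by rw [hc'.liminf_eq] : liminf a l + (b : EReal) = _).trans_le EReal.le_liminf_add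

theorem production_quotient {d N : ℕ} (ζ : E N → ℝ) (Q : E N → E d) (Ω : Set (E d))
    (u : ℝ → E d → E N) (t h : ℝ) :
    (((production ζ Q Ω u t (t + h) - production ζ Q Ω u t t) / h : ℝ) : EReal) =
      (((content ζ Ω (u (t + h)) - content ζ Ω (u t)) / h : ℝ) : EReal) +
        (((∫ s in t..(t + h), boundaryFlux Q Ω (u s)) / h : ℝ) : EReal) := by
  rw [production_self, sub_zero, production, add_div, EReal.coe_add]

/-- The upper forward rate of production is the sum of the upper forward rate of the content and
of the right limit of the boundary flux. -/
theorem upperForwardDeriv_production {d N : ℕ} {ζ : E N → ℝ} {Q : E N → E d} {Ω : Set (E d)}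
    {u : ℝ → E d → E N} {t b : ℝ}
    (hmeas : StronglyMeasurable fun s => boundaryFlux Q Ω (u s))
    (hb : Tendsto (fun s => boundaryFlux Q Ω (u s)) (𝓝[>] t) (𝓝 b)) :
    upperForwardDeriv (fun s => production ζ Q Ω u t s) t =
      upperForwardDeriv (fun s => content ζ Ω (u s)) t + (b : EReal) := by
  simp only [upperForwardDeriv, production_quotient]
  exact limsup_add_of_tendsto (tendsto_forwardAverage hmeas hb)

/-- The lower forward rate of production is the sum of the lower forward rate of the content and
of the right limit of the boundary flux. -/
theorem lowerForwardDeriv_production {d N : ℕ} {ζ : E N → ℝ} {Q : E N → E d} {Ω : Set (E d)}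
    {u : ℝ → E d → E N} {t b : ℝ}
    (hmeas : StronglyMeasurable fun s => boundaryFlux Q Ω (u s))
    (hb : Tendsto (fun s => boundaryFlux Q Ω (u s)) (𝓝[>] t) (𝓝 b)) :
    lowerForwardDeriv (fun s => production ζ Q Ω u t s) t =
      lowerForwardDeriv (fun s => content ζ Ω (u s)) t + (b : EReal) := by
  simp only [lowerForwardDeriv, production_quotient]
  exact liminf_add_of_tendsto (tendsto_forwardAverage hmeas hb)

/-! ### Comparison of a variational solution with weak solutions -/

theorem isPerturbation_zero {d N : ℕ} (Ω : Set (E d)) (t₁ t₂ : ℝ) {ε : ℝ} (hε : 0 < ε) :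
    IsPerturbation Ω t₁ t₂ ε (fun _ _ => (0 : E N)) where
  smooth := contDiff_const
  compact := HasCompactSupport.zero
  support := by
    have : tsupport (Function.uncurry fun (_ : ℝ) (_ : E d) => (0 : E N)) = ∅ :=
      tsupport_eq_empty_iff.2 rfl
    simp [this]
  small := by simpa using hε

theorem IsVariationalSolution.production_le {d N : ℕ} {f : Fin d → E N → E N}
    {𝒰 : Set (E d → E N)} {η : E N → ℝ} {q : E N → E d} {ubar u : ℝ → E d → E N}
    (hubar : IsVariationalSolution f 𝒰 η q ubar) {Ω : Set (E d)} (hΩ : IsSmoothDomain Ω)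
    {t s : ℝ} (ht : 0 ≤ t) (hts : t < s) (hu : IsWeakSolution f 𝒰 u)
    (hagree : AgreeUpTo u ubar t) :
    production η q Ω ubar t s ≤ production η q Ω u t s := by
  obtain ⟨ε, hε, hmin⟩ := hubar.minimizer
  simpa using hmin Ω hΩ t s ht hts u _ hu hagree (isPerturbation_zero Ω t s hε)

end HypCL

theorem mainTheorem2 {d N : ℕ} (f : Fin d → HypCL.E N → HypCL.E N)
    (hf : ∀ j, ContDiff ℝ 1 (f j))
    (𝒰 : Set (HypCL.E d → HypCL.E N)) (h𝒰 : 𝒰 ⊆ HypCL.BVLinf d N)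
    (η : HypCL.E N → ℝ) (q : HypCL.E N → HypCL.E d) (hη : HypCL.IsEntropyPair f η q)
    (ubar : ℝ → HypCL.E d → HypCL.E N)
    (hubar : HypCL.IsVariationalSolution f 𝒰 η q ubar)
    (Ω : Set (HypCL.E d)) (hΩ : HypCL.IsSmoothDomain Ω) (t : ℝ) (ht : 0 ≤ t)
    (u : ℝ → HypCL.E d → HypCL.E N) (hu : HypCL.IsWeakSolution f 𝒰 u)
    (hagree : HypCL.AgreeUpTo u ubar t) :
    -- the forward rates of the total local entropy production
    (HypCL.upperForwardDeriv (fun s => HypCL.production η q Ω ubar t s) t ≤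
        HypCL.upperForwardDeriv (fun s => HypCL.production η q Ω u t s) t ∧
      HypCL.lowerForwardDeriv (fun s => HypCL.production η q Ω ubar t s) t ≤
        HypCL.lowerForwardDeriv (fun s => HypCL.production η q Ω u t s) t) ∧
    -- the same, split into forward derivative and boundary flux at time `t+`
    ∀ bbar b : ℝ,
      Tendsto (fun s => HypCL.boundaryFlux q Ω (ubar s)) (𝓝[>] t) (𝓝 bbar) →
      Tendsto (fun s => HypCL.boundaryFlux q Ω (u s)) (𝓝[>] t) (𝓝 b) →
      HypCL.upperForwardDeriv (fun s => HypCL.content η Ω (ubar s)) t + (bbar : EReal) ≤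
          HypCL.upperForwardDeriv (fun s => HypCL.content η Ω (u s)) t + (b : EReal) ∧
        HypCL.lowerForwardDeriv (fun s => HypCL.content η Ω (ubar s)) t + (bbar : EReal) ≤
          HypCL.lowerForwardDeriv (fun s => HypCL.content η Ω (u s)) t + (b : EReal) := by
  have hle : ∀ s, t < s →
      HypCL.production η q Ω ubar t s ≤ HypCL.production η q Ω u t s :=
    fun s hts => hubar.production_le hΩ ht hts hu hagree
  have h₀ : HypCL.production η q Ω ubar t t = HypCL.production η q Ω u t t := by
    rw [HypCL.production_self, HypCL.production_self]
  have hupper := HypCL.upperForwardDeriv_mono h₀ hle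
  have hlower := HypCL.lowerForwardDeriv_mono h₀ hle
  refine ⟨⟨hupper, hlower⟩, fun bbar b hbbar hb => ?_⟩
  have hmeas : ∀ v : ℝ → HypCL.E d → HypCL.E N, HypCL.IsWeakSolution f 𝒰 v →
      StronglyMeasurable fun s => HypCL.boundaryFlux q Ω (v s) := fun v hv =>
    HypCL.stronglyMeasurable_boundaryFlux hη.contDiff_flux.continuous
      hΩ.isOpen.measurableSet hΩ.surfaceMeasure_frontier_lt_top hv.measurable
  have hmbar := hmeas ubar hubar.weak
  have hmu := hmeas u hu
  rw [HypCL.upperForwardDeriv_production hmbar hbbar, HypCL.upperForwardDeriv_production hmu hb]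
    at hupper
  rw [HypCL.lowerForwardDeriv_production hmbar hbbar, HypCL.lowerForwardDeriv_production hmu hb]
    at hlower
  exact ⟨hupper, hlower⟩
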